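/- A set of lines in $\mathbb{R}^d$ of $m$ colors is a union $\mathcal{L}=\mathcal{L}_1\cup\dots\cup\mathcal{L}_m$ of sets of lines (the color classes $\mathcal{L}_i$), where all lines are pairwise distinct, so that the color classes are disjoint. For $S\subseteq\{1,\dots,m\}$, an $S$-incidence in $\mathcal{L}$ is a set of lines with colors in $S$, containing at least one line of every color in $S$, that all meet at a single point. A $k$-incidence is an $S$-incidence with $|S|=k$. The set $\mathcal{L}$ is $k$-consistent if for every set $S$ of $k$ colors, every line in $\bigcup_{i\in S}\mathcal{L}_i$ belongs to an $S$-incidence. Theorem. For any integers $k\ge 3$ and $d$ with $2\le d\le k+1$, and for arbitrarily large $N\in\mathbb{N}$ (that is, for every $N_0$ there is such an $N\ge N_0$), there exists a finite set of lines in $\mathbb{R}^d$ of $k+1$ colors that is $k$-consistent, has no $(k+1)$-incidence, and in which each color class consists of at least $N$ and at most $3N$ lines, all passing through one common point. -/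

import Mathlib

namespace ColoredLines

/-- The points of `ℝ^d`. -/
abbrev Pt (d : ℕ) : Type := EuclideanSpace ℝ (Fin d)

/-- A line of `ℝ^d`: an affine subspace of dimension one (it is nonempty, since the direction of
the empty affine subspace has dimension zero). -/
def IsLine {d : ℕ} (l : AffineSubspace ℝ (Pt d)) : Prop :=
  Module.finrank ℝ l.direction = 1

/-- A finite set of lines of `m` colors in `ℝ^d`. The lines are pairwise distinct, so no line has
two colors. -/
structure LineSet (m d : ℕ) where
  /-- The color classes. -/
  color : Fin m → Finset (AffineSubspace ℝ (Pt d))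
  /-- All members are lines. -/
  isLine : ∀ i, ∀ l ∈ color i, IsLine l
  /-- Different color classes have no line in common. -/
  disjoint : ∀ i j, i ≠ j → Disjoint (color i) (color j)

/-- The members of `T` meet at a point. Two distinct lines have at most one common point, so the
point is the only common one as soon as `T` holds two distinct lines. -/
def Meet {d : ℕ} (T : Set (AffineSubspace ℝ (Pt d))) : Prop :=
  ∃ p : Pt d, ∀ l ∈ T, p ∈ l

/-- `T` is an `S`-incidence in `L`: a set of lines of `L` with colors in `S`, containing a line of
every color in `S`, that meet at a point. -/
def LineSet.IsIncidence {m d : ℕ} (L : LineSet m d) (S : Finset (Fin m))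
    (T : Set (AffineSubspace ℝ (Pt d))) : Prop :=
  (∀ l ∈ T, ∃ i ∈ S, l ∈ L.color i) ∧ (∀ i ∈ S, ∃ l ∈ T, l ∈ L.color i) ∧ Meet T

/-- `L` has a `k`-incidence: an `S`-incidence for some set `S` of `k` colors. -/
def LineSet.HasIncidence {m d : ℕ} (L : LineSet m d) (k : ℕ) : Prop :=
  ∃ S : Finset (Fin m), S.card = k ∧ ∃ T, L.IsIncidence S T

/-- `L` is `k`-consistent: for every set `S` of `k` colors, every line with color in `S` belongs
to an `S`-incidence. -/
def LineSet.Consistent {m d : ℕ} (L : LineSet m d) (k : ℕ) : Prop :=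
  ∀ S : Finset (Fin m), S.card = k → ∀ i ∈ S, ∀ l ∈ L.color i, ∃ T, L.IsIncidence S T ∧ l ∈ T

end ColoredLines

/-! The construction builds an abstract incidence structure and then realizes it generically. A
point is a potential `g` on the Boolean cube of color sets, with values in the permutations of the
colors; its coordinate `c` records the increments of `g` along edges in direction `c`. The line of
color `j` through the point forgets coordinate `j`. This leaves `g` free only by a common right
factor on the sets containing `j`, and the normalization makes that factor fix `j`. Hence `g univ j`
depends on the line alone, and the line is kept when this value is not `o`. Since `g univ` is a
bijection, each point misses exactly one color, and the free factor can make it any color other than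
`j` (`AbstractLine.exists_point`). Conversely, compatible lines of all colors would determine a
permutation that never takes the value `o` (`not_forall_abstractLine`). For the realization, labels
become real weights: a point is the weighted mean of the moment points `p_c` and the origin, the
latter with weight 1. Joining it to `p_i` forgets the weight of color `i`. For generic weights
(`exists_generic`), concurrent lines of all colors have compatible labels, so no `(k+1)`-incidence
appears. -/

namespace ColoredLines

/-! ### The abstract configuration -/

/-- The points of the abstract configuration: families of permutations indexed by sets of colors,
normalized at the empty set and at singletons. -/
def Admissible {m : ℕ} (g : Finset (Fin m) → Equiv.Perm (Fin m)) : Prop :=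
  g ∅ = 1 ∧ ∀ j, g {j} j = j

/-- The coordinate of color `c` of a family of permutations. -/
def coord {m : ℕ} (g : Finset (Fin m) → Equiv.Perm (Fin m)) (c : Fin m) :
    Finset (Fin m) → Equiv.Perm (Fin m) :=
  fun C => g C * (g (C.erase c))⁻¹

/-- The lines of color `j` of the abstract configuration with base color `o`. A line of color `j`
is represented by any `u` that lists its coordinates of colors other than `j`. -/
def AbstractLine {m : ℕ} (o j : Fin m) (u : Fin m → Finset (Fin m) → Equiv.Perm (Fin m)) : Prop :=
  ∃ g, Admissible g ∧ (∀ c, c ≠ j → u c = coord g c) ∧ g Finset.univ j ≠ o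

theorem AbstractLine.congr {m : ℕ} {o j : Fin m}
    {u v : Fin m → Finset (Fin m) → Equiv.Perm (Fin m)} (h : AbstractLine o j u)
    (huv : ∀ c, c ≠ j → v c = u c) : AbstractLine o j v := by
  obtain ⟨g, hg, hu, ho⟩ := h
  exact ⟨g, hg, fun c hc => (huv c hc).trans (hu c hc), ho⟩

theorem AbstractLine.exists_point {m : ℕ} {o j s : Fin m}
    {u : Fin m → Finset (Fin m) → Equiv.Perm (Fin m)} (h : AbstractLine o j u) (hs : s ≠ j) :
    ∃ x : Fin m → Finset (Fin m) → Equiv.Perm (Fin m),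
      (∀ c, c ≠ j → u c = x c) ∧ ∀ i, i ≠ s → AbstractLine o i x := by
  obtain ⟨g, ⟨hg0, hg1⟩, hu, ho⟩ := h
  set t := (g Finset.univ).symm o with ht
  have htj : t ≠ j := fun h => ho (by rw [← h, ht, Equiv.apply_symm_apply])
  -- Right multiplication on the sets containing `j` cancels in every increment except those in
  -- direction `j`. The swap fixes `j` and moves the preimage of `o` from `t` to `s`.
  let g' : Finset (Fin m) → Equiv.Perm (Fin m) :=
    fun C => g C * (if j ∈ C then Equiv.swap t s else 1)
  have hadm : Admissible g' := by
    refine ⟨by simp [g', hg0], fun i => ?_⟩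
    by_cases hij : j = i
    · subst hij
      simp [g', Equiv.swap_apply_of_ne_of_ne htj.symm hs.symm, hg1]
    · simp [g', hij, hg1]
  refine ⟨coord g', fun c hc => ?_, fun i hi => ⟨g', hadm, fun _ _ => rfl, fun h => hi ?_⟩⟩
  · rw [hu c hc]
    funext C
    have : (j ∈ C.erase c) ↔ j ∈ C := by simp [hc.symm]
    by_cases hj : j ∈ C <;> simp [coord, g', this, hj, mul_assoc, -Finset.mem_erase]
  · have h1 : g Finset.univ (Equiv.swap t s i) = o := by simpa [g'] using h
    have h2 : Equiv.swap t s i = t :=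
      (Equiv.symm_apply_eq _).2 h1.symm |>.symm
    rw [Equiv.swap_apply_eq_iff, Equiv.swap_apply_left] at h2
    exact h2

theorem exists_abstractLine {m : ℕ} (hm : 2 ≤ m) (o j : Fin m) :
    ∃ u, AbstractLine o j u := by
  have : Nontrivial (Fin m) := Fin.nontrivial_iff_two_le.2 hm
  obtain ⟨b, hb⟩ := exists_ne o
  let g : Finset (Fin m) → Equiv.Perm (Fin m) :=
    fun C => if C = Finset.univ then Equiv.swap j b else 1
  refine ⟨coord g, g, ⟨?_, fun i => ?_⟩, fun _ _ => rfl, by simpa [g] using hb⟩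
  · have : (∅ : Finset (Fin m)) ≠ Finset.univ := fun h => by
      have h1 := Finset.mem_univ o
      rw [← h] at h1
      simp at h1
    simp [g, this]
  · have : ({i} : Finset (Fin m)) ≠ Finset.univ := fun h => by
      obtain ⟨a, ha⟩ := exists_ne i
      have h1 := Finset.mem_univ a
      rw [← h] at h1
      exact ha (by simpa using h1)
    simp [g, this]

/-- The families `g i` need not coincide, but they yield one permutation `π`, a common value at the
full set, with `π i = g i univ i` for every `i`. The color `π⁻¹ o` then violates its own condition.
-/
theorem not_forall_abstractLine {m : ℕ} (hm : 3 ≤ m) (o : Fin m)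
    (u : Fin m → Fin m → Finset (Fin m) → Equiv.Perm (Fin m))
    (hu : ∀ i, AbstractLine o i (u i))
    (hcompat : ∀ i j c, c ≠ i → c ≠ j → u i c = u j c) : False := by
  choose g hg hug hgo using hu
  have key : ∀ i j c, c ≠ i → c ≠ j → ∀ C, c ∉ C →
      g i (insert c C) * (g i C)⁻¹ = g j (insert c C) * (g j C)⁻¹ := by
    intro i j c hi hj C hC
    have h := hcompat i j c hi hj
    rw [hug i c hi, hug j c hj] at h
    simpa [coord, Finset.erase_insert hC] using congrFun h (insert c C)
  have off : ∀ C i j, i ∉ C → j ∉ C → g i C = g j C := by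
    intro C
    induction C using Finset.induction_on with
    | empty => intro i j _ _; rw [(hg i).1, (hg j).1]
    | insert c C hc ih =>
      intro i j hi hj
      simp only [Finset.mem_insert, not_or] at hi hj
      have h := key i j c (Ne.symm hi.1) (Ne.symm hj.1) C hc
      rw [ih i j hi.2 hj.2] at h
      exact mul_right_cancel h
  -- Both families fix `i` at `{i}`, and the shared increments act on the left, so the images of `i`
  -- stay equal as the set grows.
  have on : ∀ C i j, i ∉ C → j ∉ C → i ≠ j → g i (insert i C) i = g j (insert i C) i := by
    intro C
    induction C using Finset.induction_on with
    | empty => intro i j _ _ _; simp [(hg i).2, (hg j).2]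
    | insert c C hc ih =>
      intro i j hi hj hij
      simp only [Finset.mem_insert, not_or] at hi hj
      have h := key i j c (Ne.symm hi.1) (Ne.symm hj.1) (insert i C) (by simp [hc, Ne.symm hi.1])
      rw [mul_inv_eq_iff_eq_mul] at h
      rw [Finset.insert_comm, h]
      simp [ih i j hi.2 hj.2 hij]
  have third : ∀ a b : Fin m, ∃ c, c ≠ a ∧ c ≠ b := by
    intro a b
    have : ({a, b} : Finset (Fin m)).card < (Finset.univ : Finset (Fin m)).card :=
      lt_of_le_of_lt Finset.card_le_two (by rw [Finset.card_univ, Fintype.card_fin]; omega)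
    obtain ⟨c, -, hc⟩ := Finset.exists_mem_notMem_of_card_lt_card this
    exact ⟨c, by simpa [not_or] using hc⟩
  -- This is the value at the full set computed from `g c` on the complement of `c`, where the
  -- coordinate missing from line `c` plays no role, and the last increment in direction `c`, read
  -- from line `i`.
  let top : Fin m → Fin m → Equiv.Perm (Fin m) := fun i c =>
    g i Finset.univ * (g i (Finset.univ.erase c))⁻¹ * g c (Finset.univ.erase c)
  have ins : ∀ c : Fin m, insert c (Finset.univ.erase c) = Finset.univ :=
    fun c => Finset.insert_erase (Finset.mem_univ c)
  have top_left : ∀ i j c, c ≠ i → c ≠ j → top i c = top j c := by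
    intro i j c hi hj
    have h := key i j c hi hj (Finset.univ.erase c) (by simp)
    rw [ins] at h
    simp only [top, h]
  have top_eq : ∀ i c, c ≠ i → ∀ c', c' ≠ i → c ≠ c' → top i c =
      g i Finset.univ * (g i ((Finset.univ.erase c).erase c'))⁻¹ *
        g c ((Finset.univ.erase c).erase c') := by
    intro i c hi c' hi' hcc
    have h := key i c c' hi' hcc.symm ((Finset.univ.erase c).erase c') (by simp)
    rw [Finset.insert_erase (by simpa using hcc.symm)] at h
    have h2 : g c (Finset.univ.erase c) = g i (Finset.univ.erase c) *
        (g i ((Finset.univ.erase c).erase c'))⁻¹ * g c ((Finset.univ.erase c).erase c') := by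
      rw [h]; group
    simp only [top]
    rw [h2]
    group
  have top_right : ∀ i c c', c ≠ i → c' ≠ i → top i c = top i c' := by
    intro i c c' hi hi'
    rcases eq_or_ne c c' with rfl | hcc
    · rfl
    rw [top_eq i c hi c' hi' hcc, top_eq i c' hi' c hi hcc.symm, Finset.erase_right_comm,
      off _ c c' (by simp) (by simp)]
  obtain ⟨a, ha, -⟩ := third o o
  have top_const : ∀ i c, c ≠ i → top i c = top o a := by
    intro i c hi
    obtain ⟨b, hb, hb'⟩ := third i o
    rw [top_right i c b hi hb, top_left i o b hb hb', top_right o b a hb' ha]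
  set i := (top o a).symm o with hi
  obtain ⟨c, hc, -⟩ := third i i
  have h1 : top i c i = g i Finset.univ i := by
    have h := on ((Finset.univ.erase c).erase i) i c (by simp) (by simp) hc.symm
    rw [Finset.insert_erase (by simpa using hc.symm)] at h
    simp [top, ← h]
  apply hgo i
  rw [← h1, top_const i c hc, hi, Equiv.apply_symm_apply]

/-! ### Generic choice of real labels -/

/-- Real functions given by a polynomial in the coordinates. -/
def IsPolynomialFun {σ : Type*} (F : (σ → ℝ) → ℝ) : Prop :=
  ∃ P : MvPolynomial σ ℝ, ∀ e, MvPolynomial.eval e P = F e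

namespace IsPolynomialFun

variable {σ : Type*} {F G : (σ → ℝ) → ℝ}

theorem const (r : ℝ) : IsPolynomialFun (fun _ : σ → ℝ => r) := ⟨MvPolynomial.C r, by simp⟩

theorem apply (s : σ) : IsPolynomialFun (fun e : σ → ℝ => e s) := ⟨MvPolynomial.X s, by simp⟩

theorem add (hF : IsPolynomialFun F) (hG : IsPolynomialFun G) :
    IsPolynomialFun (fun e => F e + G e) := by
  obtain ⟨P, hP⟩ := hF
  obtain ⟨Q, hQ⟩ := hG
  exact ⟨P + Q, by simp [hP, hQ]⟩

theorem sub (hF : IsPolynomialFun F) (hG : IsPolynomialFun G) :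
    IsPolynomialFun (fun e => F e - G e) := by
  obtain ⟨P, hP⟩ := hF
  obtain ⟨Q, hQ⟩ := hG
  exact ⟨P - Q, by simp [hP, hQ]⟩

theorem mul (hF : IsPolynomialFun F) (hG : IsPolynomialFun G) :
    IsPolynomialFun (fun e => F e * G e) := by
  obtain ⟨P, hP⟩ := hF
  obtain ⟨Q, hQ⟩ := hG
  exact ⟨P * Q, by simp [hP, hQ]⟩

theorem sum {ι : Type*} (s : Finset ι) {F : ι → (σ → ℝ) → ℝ}
    (hF : ∀ i, IsPolynomialFun (F i)) : IsPolynomialFun (fun e => ∑ i ∈ s, F i e) := by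
  choose P hP using hF
  exact ⟨∑ i ∈ s, P i, by simp [hP]⟩

/-- Finitely many polynomial functions, none of them identically zero, are simultaneously nonzero
at some point. -/
theorem exists_forall_ne_zero {ι : Type*} [Finite ι] {F : ι → (σ → ℝ) → ℝ}
    (hF : ∀ i, IsPolynomialFun (F i)) (hne : ∀ i, ∃ e, F i e ≠ 0) : ∃ e, ∀ i, F i e ≠ 0 := by
  cases nonempty_fintype ι
  choose P hP using hF
  have h : ∏ i, P i ≠ 0 := Finset.prod_ne_zero_iff.2 fun i _ h0 => by
    obtain ⟨e, he⟩ := hne i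
    exact he (by rw [← hP, h0, map_zero])
  by_contra! hc
  refine h (MvPolynomial.funext fun e => ?_)
  obtain ⟨i, hi⟩ := hc e
  rw [map_prod, map_zero]
  exact Finset.prod_eq_zero (Finset.mem_univ i) (by rw [hP, hi])

end IsPolynomialFun

/-- The `n`-th coordinate (counted from zero) of the point of the moment curve that the lines of
color `c` pass through. -/
def momentCoord {m : ℕ} (n : ℕ) (c : Fin m) : ℝ := ((c : ℕ) + 1 : ℝ) ^ (n + 1)

/-- The `n`-th coordinate of the direction of the line of color `i` with labels `u`, where `e` gives
the real values of the labels. -/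
def dirCoord {m : ℕ} {Ω : Type*} (n : ℕ) (i : Fin m) (u : Fin m → Ω) (e : Fin m × Ω → ℝ) : ℝ :=
  ∑ c, e (c, u c) * (momentCoord n c - momentCoord n i) - momentCoord n i

/-- The cross product of the plane projections of two directions. -/
def dirCross {m : ℕ} {Ω : Type*} (i j : Fin m) (u v : Fin m → Ω) (e : Fin m × Ω → ℝ) : ℝ :=
  dirCoord 0 i u e * dirCoord 1 j v e - dirCoord 1 i u e * dirCoord 0 j v e

/-- The constant term of the equation of the plane projection of a line. -/
def lineConst {m : ℕ} {Ω : Type*} (i : Fin m) (u : Fin m → Ω) (e : Fin m × Ω → ℝ) : ℝ :=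
  momentCoord 0 i * dirCoord 1 i u e - momentCoord 1 i * dirCoord 0 i u e

/-- The determinant that vanishes when the plane projections of three lines are concurrent. -/
def concurrence {m : ℕ} {Ω : Type*} (i j l : Fin m) (u v w : Fin m → Ω) (e : Fin m × Ω → ℝ) : ℝ :=
  lineConst i u e * dirCross j l v w e - lineConst j v e * dirCross i l u w e +
    lineConst l w e * dirCross i j u v e

section polynomial

variable {m : ℕ} {Ω : Type*}

theorem isPolynomialFun_dirCoord (n : ℕ) (i : Fin m) (u : Fin m → Ω) :
    IsPolynomialFun (dirCoord n i u) :=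
  (IsPolynomialFun.sum _ fun _ => (IsPolynomialFun.apply _).mul (.const _)).sub (.const _)

theorem isPolynomialFun_dirCross (i j : Fin m) (u v : Fin m → Ω) :
    IsPolynomialFun (dirCross i j u v) :=
  ((isPolynomialFun_dirCoord _ _ _).mul (isPolynomialFun_dirCoord _ _ _)).sub
    ((isPolynomialFun_dirCoord _ _ _).mul (isPolynomialFun_dirCoord _ _ _))

theorem isPolynomialFun_lineConst (i : Fin m) (u : Fin m → Ω) :
    IsPolynomialFun (lineConst i u) :=
  ((IsPolynomialFun.const _).mul (isPolynomialFun_dirCoord _ _ _)).sub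
    ((IsPolynomialFun.const _).mul (isPolynomialFun_dirCoord _ _ _))

theorem isPolynomialFun_concurrence (i j l : Fin m) (u v w : Fin m → Ω) :
    IsPolynomialFun (concurrence i j l u v w) :=
  (((isPolynomialFun_lineConst _ _).mul (isPolynomialFun_dirCross _ _ _ _)).sub
    ((isPolynomialFun_lineConst _ _).mul (isPolynomialFun_dirCross _ _ _ _))).add
    ((isPolynomialFun_lineConst _ _).mul (isPolynomialFun_dirCross _ _ _ _))

/-- A Vandermonde determinant: in the plane projection, two moment points are never collinear with
the origin. -/
theorem momentCross_ne_zero {i j : Fin m} (h : i ≠ j) :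
    momentCoord 0 i * momentCoord 1 j - momentCoord 1 i * momentCoord 0 j ≠ 0 := by
  have h1 : ((i : ℕ) + 1 : ℝ) ≠ 0 := by positivity
  have h2 : ((j : ℕ) + 1 : ℝ) ≠ 0 := by positivity
  have h3 : ((j : ℕ) : ℝ) - (i : ℕ) ≠ 0 := by
    rw [sub_ne_zero, Nat.cast_injective.ne_iff, Fin.val_ne_iff]
    exact h.symm
  have : momentCoord 0 i * momentCoord 1 j - momentCoord 1 i * momentCoord 0 j =
      ((i : ℕ) + 1 : ℝ) * ((j : ℕ) + 1 : ℝ) * (((j : ℕ) : ℝ) - (i : ℕ)) := by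
    unfold momentCoord; ring
  rw [this]
  exact mul_ne_zero (mul_ne_zero h1 h2) h3

theorem dirCoord_zero (n : ℕ) (i : Fin m) (u : Fin m → Ω) :
    dirCoord n i u 0 = -momentCoord n i := by
  simp [dirCoord]

open Classical in
theorem dirCoord_single (n : ℕ) (i c : Fin m) (ω : Ω) (u : Fin m → Ω) :
    dirCoord n i u (Pi.single (c, ω) 1) =
      (if u c = ω then momentCoord n c - momentCoord n i else 0) - momentCoord n i := by
  rw [dirCoord, Finset.sum_eq_single c]
  · by_cases h : u c = ω
    · simp [h]
    · simp [h]
  · intro b _ hb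
    simp [hb]
  · simp

theorem exists_dirCross_ne_zero {i j : Fin m} {u v : Fin m → Ω}
    (h : i ≠ j ∨ ∃ c, c ≠ i ∧ u c ≠ v c) : ∃ e, dirCross i j u v e ≠ 0 := by
  classical
  by_cases hij : i = j
  · subst hij
    obtain ⟨c, hc, huv⟩ := h.resolve_left fun h => h rfl
    -- The two directions become `p_c - 2 p_i` and `-p_i`.
    refine ⟨Pi.single (c, u c) 1, ?_⟩
    simp only [dirCross, dirCoord_single, huv.symm, if_true, if_false]
    have := momentCross_ne_zero hc.symm
    intro h0
    exact this (by linear_combination h0)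
  · refine ⟨0, ?_⟩
    simp only [dirCross, dirCoord_zero]
    have := momentCross_ne_zero hij
    intro h0
    exact this (by linear_combination h0)

/-- Give weight 1 to the label `u c` and 0 to all others. In the plane projection, the lines of `v`
and `w` then join `p_j` and `p_c` to the origin and meet only there, whereas the line of `u` meets
the latter at `p_c / 2`. -/
theorem exists_concurrence_ne_zero {i j c : Fin m} {u v : Fin m → Ω} (w : Fin m → Ω)
    (hci : c ≠ i) (hcj : c ≠ j) (huv : u c ≠ v c) : ∃ e, concurrence i j c u v w e ≠ 0 := by
  classical
  refine ⟨Pi.single (c, u c) 1, ?_⟩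
  have h : concurrence i j c u v w (Pi.single (c, u c) 1) =
      (momentCoord 0 i * momentCoord 1 c - momentCoord 1 i * momentCoord 0 c) *
        (momentCoord 0 j * momentCoord 1 c - momentCoord 1 j * momentCoord 0 c) := by
    simp only [concurrence, dirCross, lineConst, dirCoord_single, huv.symm, if_true, if_false,
      sub_self, ite_self]
    ring
  rw [h]
  exact mul_ne_zero (momentCross_ne_zero hci.symm) (momentCross_ne_zero hcj.symm)

/-- There are real values of the labels that satisfy no algebraic coincidence. -/
theorem exists_generic (m : ℕ) (Ω : Type*) [Finite Ω] : ∃ e : Fin m × Ω → ℝ,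
    (∀ u : Fin m → Ω, 1 + ∑ c, e (c, u c) ≠ 0) ∧
    (∀ (i j : Fin m) (u v : Fin m → Ω), (i ≠ j ∨ ∃ c, c ≠ i ∧ u c ≠ v c) →
      dirCross i j u v e ≠ 0) ∧
    ∀ (i j c : Fin m) (u v w : Fin m → Ω), c ≠ i → c ≠ j → u c ≠ v c →
      concurrence i j c u v w e ≠ 0 := by
  let ι₁ := {x : (Fin m × Fin m) × (Fin m → Ω) × (Fin m → Ω) //
    x.1.1 ≠ x.1.2 ∨ ∃ c, c ≠ x.1.1 ∧ x.2.1 c ≠ x.2.2 c}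
  let ι₂ := {x : (Fin m × Fin m × Fin m) × (Fin m → Ω) × (Fin m → Ω) × (Fin m → Ω) //
    x.1.2.2 ≠ x.1.1 ∧ x.1.2.2 ≠ x.1.2.1 ∧ x.2.1 x.1.2.2 ≠ x.2.2.1 x.1.2.2}
  let F : (Fin m → Ω) ⊕ ι₁ ⊕ ι₂ → (Fin m × Ω → ℝ) → ℝ :=
    Sum.elim (fun u e => 1 + ∑ c, e (c, u c))
      (Sum.elim (fun x => dirCross x.1.1.1 x.1.1.2 x.1.2.1 x.1.2.2)
        (fun x => concurrence x.1.1.1 x.1.1.2.1 x.1.1.2.2 x.1.2.1 x.1.2.2.1 x.1.2.2.2))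
  obtain ⟨e, he⟩ := IsPolynomialFun.exists_forall_ne_zero (F := F)
    (by
      rintro (u | x | x)
      · exact (IsPolynomialFun.const _).add (.sum _ fun _ => .apply _)
      · exact isPolynomialFun_dirCross _ _ _ _
      · exact isPolynomialFun_concurrence _ _ _ _ _ _)
    (by
      rintro (u | x | x)
      · exact ⟨0, by simp [F]⟩
      · exact exists_dirCross_ne_zero x.2
      · exact exists_concurrence_ne_zero _ x.2.1 x.2.2.1 x.2.2.2)
  exact ⟨e, fun u => he (.inl u), fun i j u v h => he (.inr (.inl ⟨((i, j), u, v), h⟩)),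
    fun i j c u v w h1 h2 h3 => he (.inr (.inr ⟨((i, j, c), u, v, w), h1, h2, h3⟩))⟩

end polynomial

/-! ### Realization by lines in Euclidean space -/

/-- The point of the moment curve that the lines of color `c` pass through. -/
noncomputable def momentPt {m : ℕ} (d : ℕ) (c : Fin m) : Pt d :=
  WithLp.toLp 2 fun n : Fin d => momentCoord n c

/-- The direction of the line of color `i` with labels `u`. -/
noncomputable def dirVec {m : ℕ} {Ω : Type*} (d : ℕ) (e : Fin m × Ω → ℝ) (i : Fin m)
    (u : Fin m → Ω) : Pt d :=
  ∑ c, e (c, u c) • (momentPt d c - momentPt d i) - momentPt d i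

/-- The line of color `i` with labels `u`. -/
noncomputable def labelLine {m : ℕ} {Ω : Type*} (d : ℕ) (e : Fin m × Ω → ℝ) (i : Fin m)
    (u : Fin m → Ω) : AffineSubspace ℝ (Pt d) :=
  AffineSubspace.mk' (momentPt d i) (Submodule.span ℝ {dirVec d e i u})

variable {m d : ℕ} {Ω : Type*} {e : Fin m × Ω → ℝ}

theorem dirVec_apply (i : Fin m) (u : Fin m → Ω) (n : Fin d) :
    dirVec d e i u n = dirCoord n i u e := by
  simp [dirVec, momentPt, dirCoord]

theorem mem_labelLine {i : Fin m} {u : Fin m → Ω} {q : Pt d} :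
    q ∈ labelLine d e i u ↔ ∃ t : ℝ, t • dirVec d e i u = q - momentPt d i := by
  rw [labelLine, AffineSubspace.mem_mk', Submodule.mem_span_singleton, vsub_eq_sub]

theorem momentPt_mem_labelLine (i : Fin m) (u : Fin m → Ω) :
    momentPt d i ∈ labelLine d e i u :=
  AffineSubspace.self_mem_mk' _ _

/-- The weight of color `i` multiplies `p_i - p_i = 0` in the direction. -/
theorem labelLine_congr {i : Fin m} {u v : Fin m → Ω} (h : ∀ c, c ≠ i → u c = v c) :
    labelLine d e i u = labelLine d e i v := by
  have : dirVec d e i u = dirVec d e i v := by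
    unfold dirVec
    congr 1
    refine Finset.sum_congr rfl fun c _ => ?_
    rcases eq_or_ne c i with rfl | hc
    · simp
    · rw [h c hc]
  rw [labelLine, this, labelLine]

/-- The common point is the weighted mean of the moment points and the origin; its difference from
`p_i` is a multiple of the direction for every `i`. -/
theorem exists_mem_labelLine {u : Fin m → Ω} (h : 1 + ∑ c, e (c, u c) ≠ 0) :
    ∃ q : Pt d, ∀ i, q ∈ labelLine d e i u := by
  refine ⟨(1 + ∑ c, e (c, u c))⁻¹ • ∑ c, e (c, u c) • momentPt d c, fun i =>
    mem_labelLine.2 ⟨(1 + ∑ c, e (c, u c))⁻¹, ?_⟩⟩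
  have : dirVec d e i u =
      ∑ c, e (c, u c) • momentPt d c - (1 + ∑ c, e (c, u c)) • momentPt d i := by
    simp only [dirVec, smul_sub, Finset.sum_sub_distrib, add_smul, one_smul, Finset.sum_smul]
    abel
  rw [this, smul_sub, inv_smul_smul₀ h]

theorem dirVec_ne_zero (hd : 2 ≤ d) {i j : Fin m} {u v : Fin m → Ω}
    (h : dirCross i j u v e ≠ 0) : dirVec d e i u ≠ 0 := by
  intro h0
  have h1 := dirVec_apply (e := e) i u (⟨0, by omega⟩ : Fin d)
  have h2 := dirVec_apply (e := e) i u (⟨1, by omega⟩ : Fin d)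
  rw [h0] at h1 h2
  simp only [PiLp.zero_apply] at h1 h2
  exact h (by rw [dirCross, ← h1, ← h2]; ring)

theorem isLine_labelLine {i : Fin m} {u : Fin m → Ω} (h : dirVec d e i u ≠ 0) :
    IsLine (labelLine d e i u) := by
  rw [IsLine, labelLine, AffineSubspace.direction_mk', finrank_span_singleton h]

theorem labelLine_ne (hd : 2 ≤ d) {i j : Fin m} {u v : Fin m → Ω}
    (h : dirCross i j u v e ≠ 0) : labelLine d e i u ≠ labelLine d e j v := by
  intro heq
  have h1 := congrArg AffineSubspace.direction heq
  simp only [labelLine, AffineSubspace.direction_mk'] at h1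
  obtain ⟨t, ht⟩ := Submodule.mem_span_singleton.1
    (h1 ▸ Submodule.mem_span_singleton_self (dirVec d e i u))
  have h2 := congrArg (fun x : Pt d => x ⟨0, by omega⟩) ht
  have h3 := congrArg (fun x : Pt d => x ⟨1, by omega⟩) ht
  simp only [PiLp.smul_apply, dirVec_apply, smul_eq_mul] at h2 h3
  exact h (by rw [dirCross, ← h2, ← h3]; ring)

theorem concurrence_eq_zero (hd : 2 ≤ d) {i j l : Fin m} {u v w : Fin m → Ω} {q : Pt d}
    (hi : q ∈ labelLine d e i u) (hj : q ∈ labelLine d e j v) (hl : q ∈ labelLine d e l w) :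
    concurrence i j l u v w e = 0 := by
  have eqn : ∀ {i : Fin m} {u : Fin m → Ω}, q ∈ labelLine d e i u →
      lineConst i u e =
        q ⟨0, by omega⟩ * dirCoord 1 i u e - q ⟨1, by omega⟩ * dirCoord 0 i u e := by
    intro i u h
    obtain ⟨t, ht⟩ := mem_labelLine.1 h
    have h2 := congrArg (fun x : Pt d => x ⟨0, by omega⟩) ht
    have h3 := congrArg (fun x : Pt d => x ⟨1, by omega⟩) ht
    simp only [PiLp.smul_apply, PiLp.sub_apply, dirVec_apply, smul_eq_mul, momentPt] at h2 h3
    rw [lineConst]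
    linear_combination dirCoord 1 i u e * h2 - dirCoord 0 i u e * h3
  rw [concurrence, eqn hi, eqn hj, eqn hl]
  simp only [dirCross]
  ring

variable {k : ℕ}

/-! ### Disjoint copies and the size of the color classes -/

/-- Labels for `N * (k + 1)` disjoint copies of the abstract configuration. In the copy `(t, r)` the
colors are shifted by `r`, which makes all color classes equally large. -/
abbrev Label (k N : ℕ) : Type :=
  Fin N × Fin (k + 1) × (Finset (Fin (k + 1)) → Equiv.Perm (Fin (k + 1)))

/-- The labels in the copy `(t, r)` of a point `u` of the abstract configuration. -/
def shiftLabel {N : ℕ} (t : Fin N) (r : Fin (k + 1))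
    (u : Fin (k + 1) → Finset (Fin (k + 1)) → Equiv.Perm (Fin (k + 1))) :
    Fin (k + 1) → Label k N :=
  fun c => (t, r, u (c + r))

open Classical in
/-- One representative for each abstract line of color `j`. -/
noncomputable def lineReps (j : Fin (k + 1)) :
    Finset (Fin (k + 1) → Finset (Fin (k + 1)) → Equiv.Perm (Fin (k + 1))) :=
  {u | AbstractLine 0 j u ∧ u j = 1}

theorem mem_lineReps {j : Fin (k + 1)}
    {u : Fin (k + 1) → Finset (Fin (k + 1)) → Equiv.Perm (Fin (k + 1))} :
    u ∈ lineReps j ↔ AbstractLine 0 j u ∧ u j = 1 := by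
  simp [lineReps]

theorem AbstractLine.update_mem_lineReps {j : Fin (k + 1)}
    {u : Fin (k + 1) → Finset (Fin (k + 1)) → Equiv.Perm (Fin (k + 1))}
    (h : AbstractLine 0 j u) : Function.update u j 1 ∈ lineReps j :=
  mem_lineReps.2 ⟨h.congr fun c hc => by simp [hc], by simp⟩

open Classical in
/-- The lines of color `j`. -/
noncomputable def colorClass (d N : ℕ) (e : Fin (k + 1) × Label k N → ℝ) (j : Fin (k + 1)) :
    Finset (AffineSubspace ℝ (Pt d)) :=
  (Finset.univ ×ˢ Finset.univ.sigma fun r => lineReps (j + r)).image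
    fun x : Fin N × (_ : Fin (k + 1)) × _ => labelLine d e j (shiftLabel x.1 x.2.1 x.2.2)

theorem mem_colorClass {N : ℕ} {e : Fin (k + 1) × Label k N → ℝ} {j : Fin (k + 1)}
    {l : AffineSubspace ℝ (Pt d)} :
    l ∈ colorClass d N e j ↔
      ∃ t r u, AbstractLine 0 (j + r) u ∧ labelLine d e j (shiftLabel t r u) = l := by
  classical
  constructor
  · intro h
    obtain ⟨⟨t, r, u⟩, hx, rfl⟩ := Finset.mem_image.1 h
    simp only [Finset.mem_product, Finset.mem_univ, Finset.mem_sigma, true_and,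
      mem_lineReps] at hx
    exact ⟨t, r, u, hx.1, rfl⟩
  · rintro ⟨t, r, u, hu, rfl⟩
    refine Finset.mem_image.2 ⟨⟨t, r, Function.update u (j + r) 1⟩, ?_, ?_⟩
    · simpa using hu.update_mem_lineReps
    · refine labelLine_congr fun c hc => ?_
      simp [shiftLabel, hc]

theorem card_colorClass {N : ℕ} {e : Fin (k + 1) × Label k N → ℝ} (hk : 1 ≤ k) (hd : 2 ≤ d)
    (he : ∀ (i j : Fin (k + 1)) (u v : Fin (k + 1) → Label k N),
      (i ≠ j ∨ ∃ c, c ≠ i ∧ u c ≠ v c) → dirCross i j u v e ≠ 0) (j : Fin (k + 1)) :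
    (colorClass d N e j).card = N * ∑ r : Fin (k + 1), (lineReps r).card := by
  classical
  rw [colorClass, Finset.card_image_of_injOn, Finset.card_product, Finset.card_sigma,
    Finset.card_univ, Fintype.card_fin,
    ← Equiv.sum_comp (Equiv.addLeft j) fun r => (lineReps r).card]
  · rfl
  rintro ⟨t, r, u⟩ hx ⟨t', r', u'⟩ hx' heq
  simp only [Finset.coe_product, Finset.coe_univ, Set.mem_prod, Set.mem_univ, true_and,
    Finset.mem_coe, Finset.mem_sigma, Finset.mem_univ, mem_lineReps] at hx hx'
  -- Genericity recovers all labels other than that of `j`; the normalization `u j = 1` in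
  -- `lineReps` fixes the remaining one.
  have agree : ∀ c, c ≠ j → shiftLabel t r u c = shiftLabel t' r' u' c := by
    by_contra! h
    exact labelLine_ne hd (he j j _ _ (.inr h)) heq
  have : Nontrivial (Fin (k + 1)) := Fin.nontrivial_iff_two_le.2 (by omega)
  obtain ⟨b, hb⟩ := exists_ne j
  have h := agree b hb
  simp only [shiftLabel, Prod.mk.injEq] at h
  obtain ⟨rfl, rfl, -⟩ := h
  have : u = u' := by
    funext c
    rcases eq_or_ne c (j + r) with rfl | hc
    · rw [hx.2, hx'.2]
    · have h := agree (c - r) (fun h => hc (by rw [← h, sub_add_cancel]))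
      simpa [shiftLabel] using h
  rw [this]

end ColoredLines

/-! ### The main theorem -/

theorem theorem1 (k d : ℕ) (hk : 3 ≤ k) (hd : 2 ≤ d) (hdk : d ≤ k + 1) (N₀ : ℕ) :
    ∃ N : ℕ, N₀ ≤ N ∧ ∃ L : ColoredLines.LineSet (k + 1) d,
      L.Consistent k ∧ ¬ L.HasIncidence (k + 1) ∧
      ∀ i : Fin (k + 1), N ≤ (L.color i).card ∧ (L.color i).card ≤ 3 * N ∧
        ColoredLines.Meet (L.color i : Set (AffineSubspace ℝ (ColoredLines.Pt d))) := by
  open ColoredLines in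
  classical
  obtain ⟨e, he_sum, he_cross, he_conc⟩ := exists_generic (k + 1) (Label k (N₀ + 1))
  have : Nontrivial (Fin (k + 1)) := Fin.nontrivial_iff_two_le.2 (by omega)
  have hline : ∀ i, ∀ l ∈ colorClass d (N₀ + 1) e i, IsLine l := by
    intro i l hl
    obtain ⟨t, r, u, -, rfl⟩ := mem_colorClass.1 hl
    obtain ⟨j, hj⟩ := exists_ne i
    exact isLine_labelLine (dirVec_ne_zero hd
      (he_cross i j _ (shiftLabel t r u) (.inl hj.symm)))
  have hdisj : ∀ i j, i ≠ j →
      Disjoint (colorClass d (N₀ + 1) e i) (colorClass d (N₀ + 1) e j) := by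
    intro i j hij
    refine Finset.disjoint_left.2 fun l hi hj => ?_
    obtain ⟨t, r, u, -, rfl⟩ := mem_colorClass.1 hi
    obtain ⟨t', r', u', -, h⟩ := mem_colorClass.1 hj
    exact labelLine_ne hd (he_cross i j _ _ (.inl hij)) h.symm
  have hcard := card_colorClass (d := d) (e := e) (by omega) hd he_cross
  have hpos : 1 ≤ ∑ r : Fin (k + 1), (lineReps r).card := by
    obtain ⟨u, hu⟩ := exists_abstractLine (by omega : 2 ≤ k + 1) 0 0
    calc 1 ≤ (lineReps (0 : Fin (k + 1))).card := Finset.card_pos.2 ⟨_, hu.update_mem_lineReps⟩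
      _ ≤ _ := Finset.single_le_sum (f := fun r : Fin (k + 1) => (lineReps r).card)
        (fun _ _ => Nat.zero_le _) (Finset.mem_univ 0)
  -- This is the exact size of every color class, because each color plays every abstract color
  -- equally often.
  refine ⟨(N₀ + 1) * ∑ r : Fin (k + 1), (lineReps r).card, by nlinarith,
    ⟨colorClass d (N₀ + 1) e, hline, hdisj⟩, ?_, ?_, fun i => ⟨(hcard i).ge, ?_, ?_⟩⟩
  · intro S hS i hi l hl
    obtain ⟨s, hs⟩ : ∃ s, s ∉ S := by
      by_contra! h
      rw [Finset.eq_univ_of_forall h, Finset.card_univ, Fintype.card_fin] at hS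
      omega
    obtain ⟨t, r, u, hu, rfl⟩ := mem_colorClass.1 hl
    -- The point on the line is chosen to miss the color `s` outside `S`; in copy `r`, color `s`
    -- plays the abstract color `s + r`.
    obtain ⟨x, hux, hx⟩ := hu.exists_point (s := s + r)
      (fun h => hs (add_right_cancel h ▸ hi))
    obtain ⟨q, hq⟩ := exists_mem_labelLine (d := d) (he_sum (shiftLabel t r x))
    refine ⟨{l | ∃ j ∈ S, l = labelLine d e j (shiftLabel t r x)}, ⟨?_, ?_, q, ?_⟩, i, hi, ?_⟩
    · rintro _ ⟨j, hj, rfl⟩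
      exact ⟨j, hj, mem_colorClass.2 ⟨t, r, x,
        hx _ fun h => hs (add_right_cancel h ▸ hj), rfl⟩⟩
    · exact fun j hj => ⟨_, ⟨j, hj, rfl⟩, mem_colorClass.2 ⟨t, r, x,
        hx _ fun h => hs (add_right_cancel h ▸ hj), rfl⟩⟩
    · rintro _ ⟨j, -, rfl⟩
      exact hq j
    · refine labelLine_congr fun c hc => ?_
      simp only [shiftLabel]
      rw [hux _ fun h => hc (add_right_cancel h)]
  · rintro ⟨S, hS, T, -, hT, q, hq⟩
    have hSu : S = Finset.univ := Finset.eq_univ_of_card S (by rw [hS, Fintype.card_fin])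
    have hex : ∀ i, ∃ t r u, AbstractLine 0 (i + r) u ∧
        q ∈ labelLine d e i (shiftLabel (N := N₀ + 1) t r u) := by
      intro i
      obtain ⟨l, hlT, hl⟩ := hT i (hSu ▸ Finset.mem_univ i)
      obtain ⟨t, r, u, hu, rfl⟩ := mem_colorClass.1 hl
      exact ⟨t, r, u, hu, hq _ hlT⟩
    choose t r u hu hqu using hex
    have agree : ∀ i j c, c ≠ i → c ≠ j →
        shiftLabel (t i) (r i) (u i) c = shiftLabel (t j) (r j) (u j) c := by
      intro i j c hi hj
      by_contra h
      exact he_conc i j c _ _ _ hi hj h (concurrence_eq_zero hd (hqu i) (hqu j) (hqu c))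
    -- Labels carry their copy, so a third color forces concurrent lines to have the same shift;
    -- undoing it gives compatible abstract lines of all colors.
    have hr : ∀ i, r i = r 0 := by
      intro i
      have : ({i, 0} : Finset (Fin (k + 1))).card < (Finset.univ : Finset (Fin (k + 1))).card :=
        lt_of_le_of_lt Finset.card_le_two (by rw [Finset.card_univ, Fintype.card_fin]; omega)
      obtain ⟨c, -, hc⟩ := Finset.exists_mem_notMem_of_card_lt_card this
      simp only [Finset.mem_insert, Finset.mem_singleton, not_or] at hc
      exact congrArg (fun x => x.2.1) (agree i 0 c hc.1 hc.2)
    refine not_forall_abstractLine (by omega : 3 ≤ k + 1) 0 (fun i => u (i - r 0))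
      (fun i => ?_) fun i j c hi hj => ?_
    · have h := hu (i - r 0)
      rwa [hr (i - r 0), sub_add_cancel] at h
    · have h := congrArg (fun x => x.2.2) (agree (i - r 0) (j - r 0) (c - r 0)
        (fun h => hi (sub_left_injective h)) (fun h => hj (sub_left_injective h)))
      simpa [shiftLabel, hr] using h
  · have h := hcard i
    simp only at h ⊢
    omega
  · refine ⟨momentPt d i, fun l hl => ?_⟩
    obtain ⟨t, r, u, -, rfl⟩ := mem_colorClass.1 hl
    exact momentPt_mem_labelLine _ _
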